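/- For a permutation $w = w_1 w_2 \cdots w_n \in \mathfrak{S}_n$ let $\mathrm{dep}(w) = \sum_{i:\, w_i > i} (w_i - i)$, let $\mathrm{inv}(w) = |\{(i,j) : i<j,\ w_i>w_j\}|$, and let $\mathrm{drops}(w) = \sum_{i<n:\, w_i > w_{i+1}} (w_i - w_{i+1})$. A descent block of $w$ is a maximal descending subword of consecutive letters; the right embracing number of $w_i$ is the number of descent blocks of length at least two that lie strictly to the right of the block containing $w_i$ and whose first letter is greater than $w_i$ and whose last letter is less than $w_i$. Let $\mathrm{Res}(w)$ be the sum of the right embracing numbers of $w_1,\dots,w_n$, and let $\mathrm{mad}(w) = \mathrm{drops}(w) + \mathrm{Res}(w)$. Write $[n]_q = 1 + q + \cdots + q^{n-1}$ (so $[0]_q = 0$). Let $R$ be a commutative ring and let $x, q \in R$ (for example $R = \mathbb{Z}[x,q]$, with $x$ and $q$ indeterminates), and let $$F_n(x,q) = \sum_{w \in \mathfrak{S}_n} x^{\mathrm{dep}(w)} q^{\mathrm{inv}(w)} \qquad (n \ge 0).$$ Then, in the ring $R[[t]]$ of formal power series, the ordinary generating function of $F_n(x,q)$ has the Jacobi continued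 fraction expansion $$\sum_{n \ge 0} F_n(x,q)\, t^n = \cfrac{1}{1 - c_0 t - \cfrac{b_1 t^2}{1 - c_1 t - \cfrac{b_2 t^2}{1 - c_2 t - \cdots}}},$$ where, for $n \ge 0$, $$c_n = x^n q^n \left([n]_q + [n+1]_q\right), \qquad b_{n+1} = x^{2n+1} q^{2n+1} \left([n+1]_q\right)^2 ;$$ that is, for every $m$, the coefficient of $t^m$ in the finite continued fraction truncated after the level $1 - c_N t$ equals that of the left-hand side for all sufficiently large $N$. Moreover, for every $n \ge 0$, $$F_n(x,q) = \sum_{w \in \mathfrak{S}_n} x^{\mathrm{drops}(w)} q^{\mathrm{mad}(w)},$$ so that the generating function $\sum_{n \ge 0} t^n \sum_{w \in \mathfrak{S}_n} x^{\mathrm{drops}(w)} q^{\mathrm{mad}(w)}$ has the same continued fraction expansion. -/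

import Mathlib

/-! ### Permutation statistics

A permutation `π` of `{1, …, n}` is modelled by `π : Equiv.Perm (Fin n)`; the word of `π` is
`π 0, π 1, …, π (n - 1)`. All statistics below only involve comparisons and differences, so they
do not depend on whether positions and values are counted from `0` or from `1`. -/

/-- The depth `dep π = ∑ (π i - i)`, summed over the excedances `i` (i.e. `i < π i`). -/
def permDep {n : ℕ} (π : Equiv.Perm (Fin n)) : ℕ :=
  ∑ i : Fin n with i < π i, ((π i : ℕ) - (i : ℕ))

/-- The number of inversions: pairs of positions `i < j` with `π i > π j`. -/
def permInv {n : ℕ} (π : Equiv.Perm (Fin n)) : ℕ :=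
  Finset.card {p : Fin n × Fin n | p.1 < p.2 ∧ π p.2 < π p.1}

/-- The sum of the descent drops `π i - π (i + 1)`, over all descents `i` of `π`. Here a descent
is represented by the pair `(i, i + 1)` of adjacent positions. -/
def permDrops {n : ℕ} (π : Equiv.Perm (Fin n)) : ℕ :=
  ∑ p : Fin n × Fin n with (p.1 : ℕ) + 1 = (p.2 : ℕ) ∧ π p.2 < π p.1,
    ((π p.1 : ℕ) - (π p.2 : ℕ))

/-- The positions `a, a + 1, …, b` form a descent block of `π`: the subword
`π a, π (a + 1), …, π b` is (nonempty and) descending, and it is maximal with this property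
among subwords of consecutive letters. Its first letter is `π a`, its last letter is `π b`. -/
def IsDescentBlock {n : ℕ} (π : Equiv.Perm (Fin n)) (a b : Fin n) : Prop :=
  a ≤ b ∧ StrictAntiOn π (Set.Icc a b) ∧
    ∀ a' b' : Fin n, a' ≤ a → b ≤ b' → StrictAntiOn π (Set.Icc a' b') → a' = a ∧ b' = b

open Classical in
/-- The right embracing number of the letter `π i`: the number of descent blocks `[a, b]` of
length at least two, lying strictly to the right of the block containing `π i` (equivalently,
starting to the right of position `i`, since the blocks partition the positions), whose first
letter is larger and whose last letter is smaller than `π i`. -/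
noncomputable def rightEmbracing {n : ℕ} (π : Equiv.Perm (Fin n)) (i : Fin n) : ℕ :=
  Finset.card {B : Fin n × Fin n |
    IsDescentBlock π B.1 B.2 ∧ B.1 < B.2 ∧ i < B.1 ∧ π i < π B.1 ∧ π B.2 < π i}

/-- The statistic `mad π = drops π + Res π`, with `Res π` the sum of all right embracing
numbers. -/
noncomputable def permMad {n : ℕ} (π : Equiv.Perm (Fin n)) : ℕ :=
  permDrops π + ∑ i : Fin n, rightEmbracing π i

/-! ### Enumerators -/

/-- The `q`-integer `[n]_q = 1 + q + ⋯ + q ^ (n - 1)`. -/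
def qInt {R : Type*} [CommRing R] (q : R) (n : ℕ) : R :=
  ∑ i ∈ Finset.range n, q ^ i

/-- `F_n(x, q)`, the enumerator of the pair `(dep, inv)` over all permutations of `n` letters. -/
def depInvPoly {R : Type*} [CommRing R] (x q : R) (n : ℕ) : R :=
  ∑ w : Equiv.Perm (Fin n), x ^ permDep w * q ^ permInv w

/-- The enumerator of the pair `(drops, mad)` over all permutations of `n` letters. -/
noncomputable def dropsMadPoly {R : Type*} [CommRing R] (x q : R) (n : ℕ) : R :=
  ∑ w : Equiv.Perm (Fin n), x ^ permDrops w * q ^ permMad w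

/-! ### Jacobi continued fractions -/

/-- The finite Jacobi continued fraction with `N + 1` levels which starts at level `k`:
`1 / (1 - c_k t - b_{k+1} t² / (1 - c_{k+1} t - ⋯ b_{k+N} t² / (1 - c_{k+N} t)))`,
a formal power series in `t`. Every denominator has constant term `1`, so `invOfUnit _ 1` is its
inverse. -/
noncomputable def jConvergent {R : Type*} [CommRing R] (c b : ℕ → R) : ℕ → ℕ → PowerSeries R
  | 0, k => PowerSeries.invOfUnit (1 - PowerSeries.C (c k) * PowerSeries.X) 1
  | N + 1, k => PowerSeries.invOfUnit
      (1 - PowerSeries.C (c k) * PowerSeries.X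
        - PowerSeries.C (b (k + 1)) * PowerSeries.X ^ 2 * jConvergent c b N (k + 1)) 1

theorem jConvergent_zero_mul {R : Type*} [CommRing R] (c b : ℕ → R) (k : ℕ) :
    (1 - PowerSeries.C (c k) * PowerSeries.X) * jConvergent c b 0 k = 1 :=
  PowerSeries.mul_invOfUnit _ _ (by simp)

theorem jConvergent_succ_mul {R : Type*} [CommRing R] (c b : ℕ → R) (N k : ℕ) :
    (1 - PowerSeries.C (c k) * PowerSeries.X
      - PowerSeries.C (b (k + 1)) * PowerSeries.X ^ 2 * jConvergent c b N (k + 1))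
      * jConvergent c b (N + 1) k = 1 :=
  PowerSeries.mul_invOfUnit _ _ (by simp)

/-- `f(t)` equals the infinite Jacobi continued fraction with coefficients `c_0, c_1, …` and
`b_1, b_2, …` (the value `b 0` is not used): its finite truncations converge to `f` as formal
power series, i.e. every coefficient is eventually equal to that of `f`. -/
def HasJFraction {R : Type*} [CommRing R] (f : PowerSeries R) (c b : ℕ → R) : Prop :=
  ∀ m : ℕ, ∀ᶠ N in Filter.atTop,
    PowerSeries.coeff m (jConvergent c b N 0) = PowerSeries.coeff m f

/-! Both enumerators count weighted Motzkin paths with the same level weights `c h` and the same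
products `b (h + 1)` of an up weight with the matching down weight. A Jacobi fraction depends only
on these data and determines its series, so the two families of polynomials agree
(`HasJFraction.unique`). For `(dep, inv)`, positions and letters are read in increasing order; the
height `h` is the number of positions (equally, of letters) still unmatched. Depth is the sum of the
heights after each step, since `π i - i` counts the steps at which `i` is pending. Matching the next
letter with a pending position, or the next position with a pending letter, removes a number of
inversions determined by ranks, whence the q-integers (`cornerPoly_succ`,
`cornerPolyAfterLetter_succ`). For `(drops, mad)`, both statistics count letters crossed by
descents: all crossings give `drops`, those to the right of the letter give `Res`. Smallest letters
are removed one at a time, and the height is the number of gaps in the remaining word that held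
removed letters, the front gap excluded (`markedPoly_succ`). -/

open PowerSeries in
/-- Flajolet's theorem on Jacobi continued fractions, for a family of power series satisfying the
first step decomposition of weighted Motzkin paths. -/
theorem hasJFraction_of_recurrence {R : Type*} [CommRing R] (c b α β : ℕ → R) (f : ℕ → ℕ → R)
    (hb : ∀ h, α h * β (h + 1) = b (h + 1)) (h00 : f 0 0 = 1) (h0 : ∀ h, f (h + 1) 0 = 0)
    (hβ : β 0 = 0)
    (hf : ∀ h m, f h (m + 1) = α h * f (h + 1) m + c h * f h m + β h * f (h - 1) m) :
    HasJFraction (PowerSeries.mk (f 0)) c b := by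
  have hF : ∀ h, PowerSeries.mk (f h) = C (f h 0) + X * (C (α h) * PowerSeries.mk (f (h + 1))
      + C (c h) * PowerSeries.mk (f h) + C (β h) * PowerSeries.mk (f (h - 1))) := by
    intro h
    ext m
    cases m with
    | zero => simp
    | succ m =>
      rw [map_add, coeff_succ_X_mul, coeff_C]
      simp [coeff_C_mul, hf]
  -- The convergent accounts for paths until they first drop below `h`; ignoring levels above `h +
  -- N` costs only `X ^ (N + 1)`. At level `h + 1` the constant term vanishes, so its series can be
  -- eliminated in favour of that at level `h`. At `h = 0`, `β 0 = 0` disposes of the truncated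
  -- index `h - 1`.
  have key : ∀ N h, ∃ g, PowerSeries.mk (f h) = jConvergent c b N h *
      (C (f h 0) + X * C (β h) * PowerSeries.mk (f (h - 1))) + X ^ (N + 1) * g := by
    intro N
    induction N with
    | zero =>
      intro h
      refine ⟨jConvergent c b 0 h * (C (α h) * PowerSeries.mk (f (h + 1))), ?_⟩
      linear_combination jConvergent c b 0 h * hF h
        - PowerSeries.mk (f h) * jConvergent_zero_mul c b h
    | succ N ih =>
      intro h
      obtain ⟨g, hg⟩ := ih (h + 1)
      refine ⟨jConvergent c b (N + 1) h * (C (α h) * g), ?_⟩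
      have hb' : (C (α h) : R⟦X⟧) * C (β (h + 1)) = C (b (h + 1)) := by rw [← map_mul, hb]
      rw [h0 h, map_zero, zero_add, Nat.add_sub_cancel] at hg
      linear_combination jConvergent c b (N + 1) h * hF h
        - PowerSeries.mk (f h) * jConvergent_succ_mul c b N h
        + jConvergent c b (N + 1) h * X * C (α h) * hg
        + jConvergent c b (N + 1) h * X ^ 2 * jConvergent c b N (h + 1) * PowerSeries.mk (f h) * hb'
  intro m
  filter_upwards [Filter.eventually_ge_atTop m] with N hN
  obtain ⟨g, hg⟩ := key N 0
  rw [h00, hβ] at hg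
  rw [hg, map_add, coeff_X_pow_mul', if_neg (by omega)]
  simp

/-- A power series is determined by its Jacobi continued fraction. -/
theorem HasJFraction.unique {R : Type*} [CommRing R] {f g : PowerSeries R} {c b : ℕ → R}
    (hf : HasJFraction f c b) (hg : HasJFraction g c b) : f = g := by
  ext m
  obtain ⟨N, h1, h2⟩ := ((hf m).and (hg m)).exists
  rw [← h1, h2]

/-! ### Inserting a letter, and inversions -/

/-- Insert the letter `v` at position `i` into the word of `w`. -/
def insertPerm {n : ℕ} (i v : Fin (n + 1)) (w : Equiv.Perm (Fin n)) : Equiv.Perm (Fin (n + 1)) :=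
  (finSuccEquiv' i).trans ((Equiv.optionCongr w).trans (finSuccEquiv' v).symm)

@[simp]
theorem insertPerm_apply_self {n : ℕ} (i v : Fin (n + 1)) (w : Equiv.Perm (Fin n)) :
    insertPerm i v w i = v := by
  simp [insertPerm]

@[simp]
theorem insertPerm_apply_succAbove {n : ℕ} (i v : Fin (n + 1)) (w : Equiv.Perm (Fin n))
    (j : Fin n) : insertPerm i v w (i.succAbove j) = v.succAbove (w j) := by
  simp [insertPerm]

theorem insertPerm_injective {n : ℕ} (i v : Fin (n + 1)) :
    Function.Injective (insertPerm i v : Equiv.Perm (Fin n) → _) := by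
  intro w w' h
  ext1 j
  have := congrArg (fun e : Equiv.Perm (Fin (n + 1)) => e (i.succAbove j)) h
  simpa using this

theorem sum_perm_insert_letter {n : ℕ} {M : Type*} [AddCommMonoid M] (i : Fin (n + 1))
    (f : Equiv.Perm (Fin (n + 1)) → M) :
    ∑ w, f w = ∑ v, ∑ w, f (insertPerm i v w) := by
  rw [← Fintype.sum_prod_type']
  refine (Function.Bijective.sum_comp (e := fun p : Fin (n + 1) × Equiv.Perm (Fin n) =>
    insertPerm i p.1 p.2) ?_ f).symm
  rw [Fintype.bijective_iff_injective_and_card]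
  refine ⟨?_, by simp [Fintype.card_perm, Nat.factorial_succ]⟩
  rintro ⟨v, w⟩ ⟨v', w'⟩ h
  have hv : v = v' := by
    have := congrArg (fun e : Equiv.Perm (Fin (n + 1)) => e i) h
    simpa using this
  subst hv
  exact congrArg (Prod.mk _) (insertPerm_injective i v h)

theorem sum_perm_insert_position {n : ℕ} {M : Type*} [AddCommMonoid M] (v : Fin (n + 1))
    (f : Equiv.Perm (Fin (n + 1)) → M) :
    ∑ w, f w = ∑ i, ∑ w, f (insertPerm i v w) := by
  rw [← Fintype.sum_prod_type']
  refine (Function.Bijective.sum_comp (e := fun p : Fin (n + 1) × Equiv.Perm (Fin n) =>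
    insertPerm p.1 v p.2) ?_ f).symm
  rw [Fintype.bijective_iff_injective_and_card]
  refine ⟨?_, by simp [Fintype.card_perm, Nat.factorial_succ]⟩
  rintro ⟨i, w⟩ ⟨i', w'⟩ h
  have hi : i = i' := by
    have := congrArg (fun e : Equiv.Perm (Fin (n + 1)) => e.symm v) h
    simp only at this
    rwa [(Equiv.symm_apply_eq _).2 (insertPerm_apply_self i v w).symm,
      (Equiv.symm_apply_eq _).2 (insertPerm_apply_self i' v w').symm] at this
  subst hi
  exact congrArg (Prod.mk _) (insertPerm_injective i v h)

theorem permInv_eq_sum {n : ℕ} (w : Equiv.Perm (Fin n)) :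
    permInv w = ∑ i, ∑ j, if i < j ∧ w j < w i then 1 else 0 := by
  rw [permInv, Finset.card_filter, Fintype.sum_prod_type]

theorem permInv_insertPerm {n : ℕ} (i v : Fin (n + 1)) (w : Equiv.Perm (Fin n)) :
    permInv (insertPerm i v w) = permInv w
      + Finset.card {j | j < i ∧ v < insertPerm i v w j}
      + Finset.card {j | i < j ∧ insertPerm i v w j < v} := by
  simp only [permInv_eq_sum, Finset.card_filter, Fin.sum_univ_succAbove _ i,
    insertPerm_apply_self, insertPerm_apply_succAbove, Fin.succAbove_lt_succAbove_iff,
    lt_self_iff_false, and_false, if_false, Finset.sum_add_distrib]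
  ring

/-! ### Corner-avoiding permutations: depth and inversions -/

/-- The permutations which map none of the first `a` positions to one of the `b` smallest
letters. -/
def AvoidsCorner {n : ℕ} (a b : ℕ) (w : Equiv.Perm (Fin n)) : Prop :=
  ∀ j : Fin n, (j : ℕ) < a → b ≤ (w j : ℕ)

instance {n : ℕ} (a b : ℕ) (w : Equiv.Perm (Fin n)) : Decidable (AvoidsCorner a b w) :=
  inferInstanceAs (Decidable (∀ j : Fin n, (j : ℕ) < a → b ≤ (w j : ℕ)))

/-- Corner avoidance forces every possible inversion with the inserted entry: the `i` earlier
positions carry letters above `v`, and the `v` smaller letters sit to the right of `i`. -/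
theorem permInv_insertPerm_of_avoidsCorner {n a b : ℕ} {i v : Fin (n + 1)}
    {w : Equiv.Perm (Fin n)} (h : AvoidsCorner a b (insertPerm i v w)) (hi : (i : ℕ) ≤ a)
    (hv : (v : ℕ) ≤ b) :
    permInv (insertPerm i v w) = permInv w + i + v := by
  have hne : ∀ j, j ≠ i → insertPerm i v w j ≠ v := fun j hj hjv =>
    hj ((insertPerm i v w).injective (hjv.trans (insertPerm_apply_self i v w).symm))
  have h1 : Finset.card {j | j < i ∧ v < insertPerm i v w j} = (i : ℕ) := by
    rw [← Fin.card_Iio]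
    congr 1
    ext j
    simp only [Finset.mem_filter, Finset.mem_univ, true_and, Finset.mem_Iio, and_iff_left_iff_imp]
    intro hj
    have := h j (by omega)
    have := hne j hj.ne
    omega
  have h2 : Finset.card {j | i < j ∧ insertPerm i v w j < v} = (v : ℕ) := by
    rw [← Fin.card_Iio v, ← Finset.card_map (insertPerm i v w).toEmbedding]
    congr 1
    ext j
    simp only [Finset.mem_filter, Finset.mem_univ, true_and, Finset.mem_map_equiv,
      Equiv.apply_symm_apply, Finset.mem_Iio, and_iff_right_iff_imp]
    intro hj
    have hji : (insertPerm i v w).symm j ≠ i := by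
      rw [Ne, Equiv.symm_apply_eq, insertPerm_apply_self]
      exact hj.ne
    by_contra hlt
    have := h ((insertPerm i v w).symm j) (by omega)
    rw [Equiv.apply_symm_apply] at this
    omega
  rw [permInv_insertPerm, h1, h2]

theorem avoidsCorner_insertPerm_iff_of_lt_left {n a b : ℕ} {i v : Fin (n + 1)}
    (w : Equiv.Perm (Fin n)) (hi : (i : ℕ) < a) (hv : (v : ℕ) = b) :
    AvoidsCorner a b (insertPerm i v w) ↔ AvoidsCorner (a - 1) b w := by
  unfold AvoidsCorner
  rw [Fin.forall_iff_succAbove i]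
  simp only [insertPerm_apply_self, insertPerm_apply_succAbove, hv, le_refl, implies_true,
    true_and]
  refine forall_congr' fun j => ?_
  simp only [Fin.succAbove, Fin.lt_def, Fin.val_castSucc]
  split_ifs <;> simp <;> omega

theorem avoidsCorner_insertPerm_iff_of_lt_right {n a b : ℕ} {i v : Fin (n + 1)}
    (w : Equiv.Perm (Fin n)) (hi : (i : ℕ) = a) (hv : (v : ℕ) < b) :
    AvoidsCorner a b (insertPerm i v w) ↔ AvoidsCorner a (b - 1) w := by
  unfold AvoidsCorner
  rw [Fin.forall_iff_succAbove i]
  simp only [insertPerm_apply_self, insertPerm_apply_succAbove, hi, lt_self_iff_false,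
    false_imp_iff, true_and]
  refine forall_congr' fun j => ?_
  simp only [Fin.succAbove, Fin.lt_def, Fin.val_castSucc]
  split_ifs <;> simp <;> omega

/-- The depth which remains if the first `a` positions and the `b` smallest letters count as
equal to `0` and the remaining ones are renumbered accordingly. -/
def cornerDep {n : ℕ} (a b : ℕ) (w : Equiv.Perm (Fin n)) : ℕ :=
  ∑ j, (((w j : ℕ) - b) - ((j : ℕ) - a))

/-- As `cornerDep`, at a moment when one more letter than positions has been read. -/
def cornerDepAfterLetter {n : ℕ} (a b : ℕ) (w : Equiv.Perm (Fin n)) : ℕ :=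
  ∑ j, (((w j : ℕ) + 1 - b) - ((j : ℕ) - a))

theorem cornerDepAfterLetter_succ {n : ℕ} (a b : ℕ) (w : Equiv.Perm (Fin n)) :
    cornerDepAfterLetter a (b + 1) w = cornerDep a b w := by
  simp [cornerDepAfterLetter, cornerDep]

theorem cornerDep_insertPerm {n a b : ℕ} {i v : Fin (n + 1)}
    (w : Equiv.Perm (Fin n)) (hi : (i : ℕ) < a) (hv : (v : ℕ) = b) :
    cornerDep a b (insertPerm i v w) = cornerDepAfterLetter (a - 1) b w := by
  unfold cornerDep cornerDepAfterLetter
  rw [Fin.sum_univ_succAbove _ i]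
  simp only [insertPerm_apply_self, insertPerm_apply_succAbove, hv, Nat.sub_self, Nat.zero_sub,
    zero_add]
  refine Finset.sum_congr rfl fun j _ => ?_
  simp only [Fin.succAbove, Fin.lt_def, Fin.val_castSucc]
  split_ifs <;> simp <;> omega

theorem card_val_lt {n a : ℕ} (h : a ≤ n) : Finset.card {j : Fin n | (j : ℕ) < a} = a := by
  simp [Fin.card_filter_val_lt, h]

/-- Each of the `a + 1` pending positions contributes one unit of depth at this step; for later
positions the shifts of letter and position cancel. -/
theorem cornerDepAfterLetter_of_avoidsCorner {n a b : ℕ} {w : Equiv.Perm (Fin n)}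
    (hw : AvoidsCorner (a + 1) b w) (ha : a + 1 ≤ n) :
    cornerDepAfterLetter a b w = (a + 1) + cornerDep (a + 1) b w := by
  refine Eq.trans ?_ (congrArg (· + cornerDep (a + 1) b w) (card_val_lt ha))
  unfold cornerDep cornerDepAfterLetter
  rw [Finset.card_filter, ← Finset.sum_add_distrib]
  refine Finset.sum_congr rfl fun j _ => ?_
  have := hw j
  split_ifs <;> omega

theorem cornerDepAfterLetter_insertPerm {n a b : ℕ} {i v : Fin (n + 1)}
    {w : Equiv.Perm (Fin n)} (hw : AvoidsCorner a (b - 1) w) (hi : (i : ℕ) = a)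
    (hv : (v : ℕ) < b) :
    cornerDepAfterLetter a b (insertPerm i v w) = a + cornerDep a (b - 1) w := by
  have ha : a ≤ n := by omega
  refine Eq.trans ?_ (congrArg (· + cornerDep a (b - 1) w) (card_val_lt ha))
  unfold cornerDep cornerDepAfterLetter
  rw [Fin.sum_univ_succAbove _ i, Finset.card_filter, ← Finset.sum_add_distrib]
  simp only [insertPerm_apply_self, insertPerm_apply_succAbove]
  rw [show (v : ℕ) + 1 - b - ((i : ℕ) - a) = 0 by omega, zero_add]
  refine Finset.sum_congr rfl fun j _ => ?_
  have := hw j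
  simp only [Fin.succAbove, Fin.lt_def, Fin.val_castSucc]
  split_ifs <;> simp <;> omega

theorem sum_fin_pow_eq_qInt {R : Type*} [CommRing R] (q : R) {n a : ℕ} (h : a ≤ n) :
    (∑ i : Fin n, if (i : ℕ) < a then q ^ (i : ℕ) else 0) = qInt q a := by
  rw [Fin.sum_univ_eq_sum_range (fun i => if i < a then q ^ i else 0), ← Finset.sum_filter, qInt]
  congr 1
  ext i
  simp only [Finset.mem_filter, Finset.mem_range]
  omega

section Corner

variable {R : Type*} [CommRing R] (x q : R)

/-- The enumerator of inversions and remaining depth over the permutations avoiding a corner. -/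
def cornerPoly (n a b : ℕ) : R :=
  ∑ w : Equiv.Perm (Fin n), if AvoidsCorner a b w then x ^ cornerDep a b w * q ^ permInv w else 0

/-- As `cornerPoly`, at a moment when one more letter than positions has been read. -/
def cornerPolyAfterLetter (n a b : ℕ) : R :=
  ∑ w : Equiv.Perm (Fin n),
    if AvoidsCorner a b w then x ^ cornerDepAfterLetter a b w * q ^ permInv w else 0

/-- The letter `b` either stays pending or fills a pending position `i < a`. Deleting it in the
latter case removes `i + b` inversions, and summing over `i` gives `q ^ b * qInt q a`. -/
theorem cornerPoly_succ {n a b : ℕ} (ha : a ≤ n + 1) (hb : b ≤ n) :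
    cornerPoly x q (n + 1) a b = cornerPolyAfterLetter x q (n + 1) a (b + 1)
      + q ^ b * qInt q a * cornerPolyAfterLetter x q n (a - 1) b := by
  have hsplit : cornerPoly x q (n + 1) a b = cornerPolyAfterLetter x q (n + 1) a (b + 1)
      + ∑ i : Fin (n + 1), ∑ w, if (i : ℕ) < a then
        (if AvoidsCorner a b (insertPerm i ⟨b, by omega⟩ w) then
          x ^ cornerDep a b (insertPerm i ⟨b, by omega⟩ w)
            * q ^ permInv (insertPerm i ⟨b, by omega⟩ w) else 0) else 0 := by
    have h : ∀ w : Equiv.Perm (Fin (n + 1)),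
        (if AvoidsCorner a b w then x ^ cornerDep a b w * q ^ permInv w else 0)
        = (if AvoidsCorner a (b + 1) w then
            x ^ cornerDepAfterLetter a (b + 1) w * q ^ permInv w else 0)
          + if ((w.symm ⟨b, by omega⟩ : Fin (n + 1)) : ℕ) < a then
            (if AvoidsCorner a b w then x ^ cornerDep a b w * q ^ permInv w else 0) else 0 := by
      intro w
      have hw : (w (w.symm ⟨b, by omega⟩) : ℕ) = b := by simp
      have hiff : AvoidsCorner a (b + 1) w ↔
          AvoidsCorner a b w ∧ ¬ ((w.symm ⟨b, by omega⟩ : Fin (n + 1)) : ℕ) < a := by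
        constructor
        · intro h
          refine ⟨fun j hj => by have := h j hj; omega, fun hlt => ?_⟩
          have := h _ hlt
          omega
        · rintro ⟨h, h'⟩ j hj
          have h1 := h j hj
          have h2 : (w j : ℕ) ≠ b := by
            rintro hjb
            apply h'
            rwa [show w.symm ⟨b, by omega⟩ = j from (Equiv.symm_apply_eq _).2 (Fin.ext hjb.symm)]
          omega
      rw [cornerDepAfterLetter_succ]
      simp only [hiff]
      split_ifs <;> simp_all
    rw [cornerPoly, Finset.sum_congr rfl fun w _ => h w, Finset.sum_add_distrib,
      ← cornerPolyAfterLetter]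
    congr 1
    rw [sum_perm_insert_position ⟨b, by omega⟩]
    refine Finset.sum_congr rfl fun i _ => Finset.sum_congr rfl fun w _ => ?_
    rw [(Equiv.symm_apply_eq _).2 (insertPerm_apply_self i ⟨b, by omega⟩ w).symm]
  rw [hsplit, ← sum_fin_pow_eq_qInt q ha]
  congr 1
  rw [Finset.mul_sum, Finset.sum_mul]
  refine Finset.sum_congr rfl fun i _ => ?_
  rw [cornerPolyAfterLetter, Finset.mul_sum]
  refine Finset.sum_congr rfl fun w _ => ?_
  by_cases hi : (i : ℕ) < a
  · have hv := avoidsCorner_insertPerm_iff_of_lt_left (b := b) (v := ⟨b, by omega⟩) w hi rfl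
    rw [if_pos hi, if_pos hi]
    by_cases hw : AvoidsCorner (a - 1) b w
    · rw [if_pos hw, if_pos (hv.2 hw), cornerDep_insertPerm (b := b) w hi rfl,
        permInv_insertPerm_of_avoidsCorner (hv.2 hw) hi.le le_rfl]
      ring
    · rw [if_neg hw, if_neg (mt hv.1 hw), mul_zero]
  · simp [hi]

/-- Dually, the position `a` either stays pending or takes a pending letter `v < b`, which accounts
for `a + v` inversions. The power of `x` counts the positions pending afterwards. -/
theorem cornerPolyAfterLetter_succ {n a b : ℕ} (ha : a ≤ n) (hb : b ≤ n + 1) :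
    cornerPolyAfterLetter x q (n + 1) a b = x ^ (a + 1) * cornerPoly x q (n + 1) (a + 1) b
      + q ^ a * x ^ a * qInt q b * cornerPoly x q n a (b - 1) := by
  have hsplit : cornerPolyAfterLetter x q (n + 1) a b
      = x ^ (a + 1) * cornerPoly x q (n + 1) (a + 1) b
      + ∑ v : Fin (n + 1), ∑ w, if (v : ℕ) < b then
        (if AvoidsCorner a b (insertPerm ⟨a, by omega⟩ v w) then
          x ^ cornerDepAfterLetter a b (insertPerm ⟨a, by omega⟩ v w)
            * q ^ permInv (insertPerm ⟨a, by omega⟩ v w) else 0) else 0 := by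
    have h : ∀ w : Equiv.Perm (Fin (n + 1)),
        (if AvoidsCorner a b w then x ^ cornerDepAfterLetter a b w * q ^ permInv w else 0)
        = x ^ (a + 1) * (if AvoidsCorner (a + 1) b w then
            x ^ cornerDep (a + 1) b w * q ^ permInv w else 0)
          + if (w ⟨a, by omega⟩ : ℕ) < b then
            (if AvoidsCorner a b w then
              x ^ cornerDepAfterLetter a b w * q ^ permInv w else 0) else 0 := by
      intro w
      have hiff : AvoidsCorner (a + 1) b w ↔ AvoidsCorner a b w ∧ ¬ (w ⟨a, by omega⟩ : ℕ) < b := by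
        constructor
        · intro h
          exact ⟨fun j hj => h j (by omega), not_lt.2 (h ⟨a, by omega⟩ (by simp))⟩
        · rintro ⟨h, h'⟩ j hj
          rcases Nat.lt_succ_iff_lt_or_eq.1 hj with hj | hj
          · exact h j hj
          · rw [show j = ⟨a, by omega⟩ from Fin.ext hj]
            exact not_lt.1 h'
      by_cases hw : AvoidsCorner (a + 1) b w
      · rw [if_pos hw, if_pos (hiff.1 hw).1, if_neg (hiff.1 hw).2,
          cornerDepAfterLetter_of_avoidsCorner hw (by omega)]
        ring
      · rw [if_neg hw]
        rw [hiff] at hw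
        split_ifs <;> simp_all
    rw [cornerPolyAfterLetter, Finset.sum_congr rfl fun w _ => h w, Finset.sum_add_distrib,
      ← Finset.mul_sum, ← cornerPoly]
    congr 1
    rw [sum_perm_insert_letter ⟨a, by omega⟩]
    refine Finset.sum_congr rfl fun i _ => Finset.sum_congr rfl fun w _ => ?_
    rw [insertPerm_apply_self]
  rw [hsplit, ← sum_fin_pow_eq_qInt q hb]
  congr 1
  rw [Finset.mul_sum, Finset.sum_mul]
  refine Finset.sum_congr rfl fun v _ => ?_
  rw [cornerPoly, Finset.mul_sum]
  refine Finset.sum_congr rfl fun w _ => ?_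
  by_cases hv : (v : ℕ) < b
  · have hi := avoidsCorner_insertPerm_iff_of_lt_right (a := a) (i := ⟨a, by omega⟩) w rfl hv
    rw [if_pos hv, if_pos hv]
    by_cases hw : AvoidsCorner a (b - 1) w
    · rw [if_pos hw, if_pos (hi.2 hw), cornerDepAfterLetter_insertPerm hw rfl hv,
        permInv_insertPerm_of_avoidsCorner (hi.2 hw) le_rfl hv.le]
      ring
    · rw [if_neg hw, if_neg (mt hi.1 hw), mul_zero]
  · simp [hv]

theorem cornerPoly_zero_zero (n : ℕ) : cornerPoly x q n 0 0 = depInvPoly x q n := by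
  refine Finset.sum_congr rfl fun w _ => ?_
  rw [if_pos (show AvoidsCorner 0 0 w from fun j _ => Nat.zero_le _)]
  congr 2
  rw [permDep, Finset.sum_filter]
  refine Finset.sum_congr rfl fun j _ => ?_
  split_ifs <;> simp; omega

theorem cornerPoly_self_succ {h : ℕ} : cornerPoly x q (h + 1) (h + 1) (h + 1) = 0 := by
  refine Finset.sum_eq_zero fun w _ => if_neg fun hw => ?_
  have := hw 0 (by simp)
  omega

theorem qInt_zero : qInt q 0 = 0 := by simp [qInt]

theorem hasJFraction_depInvPoly (c b : ℕ → R)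
    (hc : ∀ n : ℕ, c n = x ^ n * q ^ n * (qInt q n + qInt q (n + 1)))
    (hb : ∀ n : ℕ, b (n + 1) = x ^ (2 * n + 1) * q ^ (2 * n + 1) * qInt q (n + 1) ^ 2) :
    HasJFraction (PowerSeries.mk fun n => depInvPoly x q n) c b := by
  have key := hasJFraction_of_recurrence c b (fun h => x ^ (h + 1))
    (fun h => x ^ (h - 1) * q ^ (2 * h - 1) * qInt q h ^ 2)
    (fun h m => cornerPoly x q (h + m) h h) ?_ ?_ ?_ ?_ ?_
  · convert key using 2
    ext n
    rw [zero_add, cornerPoly_zero_zero]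
  · intro h
    rw [hb, Nat.add_sub_cancel, show 2 * (h + 1) - 1 = 2 * h + 1 by omega]
    ring
  · rw [add_zero, cornerPoly_zero_zero]
    simp [depInvPoly, permDep, permInv]
  · intro h
    exact cornerPoly_self_succ x q
  · simp [qInt_zero]
  · intro h m
    rw [← add_assoc, cornerPoly_succ x q (by omega) (by omega),
      cornerPolyAfterLetter_succ x q (by omega) (by omega), Nat.add_sub_cancel, hc,
      show h + 1 + m = h + m + 1 by omega]
    -- At height `0` nothing is pending, and `qInt q 0 = 0` removes the term with truncated index.
    cases h with
    | zero => simp [qInt_zero]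
    | succ k =>
      rw [show k + 1 + m = k + m + 1 by omega, Nat.add_sub_cancel,
        cornerPolyAfterLetter_succ x q (n := k + m) (a := k) (by omega) (by omega),
        Nat.add_sub_cancel, show 2 * (k + 1) - 1 = 2 * k + 1 by omega]
      ring

end Corner

/-! ### Crossings of letters by descents -/

/-- The descents of the word of `w`, where the positions in `S` count as followed by an
additional smallest letter, which pass from above the letter `v` to at most `v`. -/
def CrossesAt {n : ℕ} (w : Equiv.Perm (Fin n)) (S : Fin n → Bool) (v j : Fin n) : Prop :=
  v < w j ∧ (S j = true ∨ ∃ k : Fin n, (j : ℕ) + 1 = k ∧ w k ≤ v)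

/-- The marked positions after deletion of the position `p` at which the smallest letter sits:
the position before `p` becomes marked. -/
def closeGap {n : ℕ} (p : Fin (n + 1)) (S : Fin n → Bool) : Fin n → Bool :=
  fun j => S j || decide (j.succ = p)

theorem closeGap_zero {n : ℕ} (S : Fin n → Bool) : closeGap 0 S = S := by
  ext j
  simp [closeGap, Fin.succ_ne_zero]

theorem closeGap_succ {n : ℕ} (g : Fin n) (S : Fin n → Bool) :
    closeGap g.succ S = Function.update S g true := by
  ext j
  by_cases h : j = g <;> simp [closeGap, h]

section Insert

variable {n : ℕ} (p : Fin (n + 1)) (w : Equiv.Perm (Fin n)) (r : Bool) (S : Fin n → Bool)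

/-- The letter `0` is crossed only at marks and at the descent into `0` itself, which starts just
before `p`. -/
theorem crossesAt_insertPerm_zero (j : Fin n) :
    CrossesAt (insertPerm p 0 w) (p.insertNth r S) 0 (p.succAbove j) ↔
      closeGap p S j = true := by
  simp only [CrossesAt, insertPerm_apply_succAbove, Fin.succAbove_zero, Fin.succ_pos, true_and,
    Fin.insertNth_apply_succAbove, closeGap, Bool.or_eq_true, decide_eq_true_eq]
  refine or_congr Iff.rfl ?_
  constructor
  · rintro ⟨k, hk, hk0⟩
    have : k = p := by
      apply (insertPerm p 0 w).injective
      rw [insertPerm_apply_self]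
      exact le_antisymm hk0 (Fin.zero_le _)
    subst this
    ext
    rw [Fin.val_succ]
    simp only [Fin.succAbove, Fin.lt_def, Fin.val_castSucc] at hk
    split_ifs at hk <;> simp at hk <;> omega
  · rintro rfl
    exact ⟨j.succ, by simp [Fin.succAbove, Fin.lt_def], by simp⟩

theorem not_crossesAt_insertPerm_self (v : Fin (n + 1)) :
    ¬ CrossesAt (insertPerm p 0 w) (p.insertNth r S) v p := by
  simp [CrossesAt]

/-- A descent into `0` crosses a larger letter exactly when a mark at the same place would, so `0`
can be traded for a mark. -/
theorem crossesAt_insertPerm_succ (v j : Fin n) :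
    CrossesAt (insertPerm p 0 w) (p.insertNth r S) v.succ (p.succAbove j) ↔
      CrossesAt w (closeGap p S) v j := by
  simp only [CrossesAt, insertPerm_apply_succAbove, Fin.succAbove_zero, Fin.succ_lt_succ_iff,
    Fin.insertNth_apply_succAbove, closeGap, Bool.or_eq_true, decide_eq_true_eq]
  refine and_congr Iff.rfl ?_
  rw [or_assoc]
  refine or_congr Iff.rfl ?_
  rw [Fin.exists_iff_succAbove p]
  simp only [insertPerm_apply_self, insertPerm_apply_succAbove, Fin.succAbove_zero,
    Fin.succ_le_succ_iff, Fin.zero_le, and_true]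
  by_cases hp : j.succ = p
  · subst hp
    simp [Fin.succAbove, Fin.lt_def]
  · have h1 : ¬ ((p.succAbove j : Fin (n + 1)) : ℕ) + 1 = p := by
      rw [Fin.ext_iff, Fin.val_succ] at hp
      simp only [Fin.succAbove, Fin.lt_def, Fin.val_castSucc]
      split_ifs <;> simp <;> omega
    simp only [h1, hp, false_or]
    refine exists_congr fun k => and_congr ?_ Iff.rfl
    rw [Fin.ext_iff, Fin.val_succ] at hp
    simp only [Fin.succAbove, Fin.lt_def, Fin.val_castSucc]
    split_ifs <;> simp <;> omega

open Classical in
/-- The total number of crossings of letters by descents. -/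
noncomputable def crossTotal {n : ℕ} (w : Equiv.Perm (Fin n)) (S : Fin n → Bool) : ℕ :=
  ∑ i, Finset.card {j | CrossesAt w S (w i) j}

open Classical in
/-- The number of crossings of letters by descents to their right. -/
noncomputable def crossRight {n : ℕ} (w : Equiv.Perm (Fin n)) (S : Fin n → Bool) : ℕ :=
  ∑ i, Finset.card {j | i < j ∧ CrossesAt w S (w i) j}

theorem crossTotal_insertPerm :
    crossTotal (insertPerm p 0 w) (p.insertNth r S) =
      Finset.card {j | closeGap p S j = true} + crossTotal w (closeGap p S) := by
  classical
  simp only [crossTotal, Finset.card_filter, Fin.sum_univ_succAbove _ p, insertPerm_apply_self,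
    insertPerm_apply_succAbove, not_crossesAt_insertPerm_self, crossesAt_insertPerm_zero,
    Fin.succAbove_zero, crossesAt_insertPerm_succ, if_false, zero_add]

theorem crossRight_insertPerm :
    crossRight (insertPerm p 0 w) (p.insertNth r S) =
      Finset.card {j : Fin n | p < j.succ ∧ closeGap p S j = true}
        + crossRight w (closeGap p S) := by
  classical
  have h : ∀ j : Fin n, p < p.succAbove j ↔ p < j.succ := fun j => by
    simp only [Fin.succAbove, Fin.lt_def, Fin.val_castSucc]
    split_ifs <;> simp; omega
  simp only [crossRight, Finset.card_filter, Fin.sum_univ_succAbove _ p, insertPerm_apply_self,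
    insertPerm_apply_succAbove, not_crossesAt_insertPerm_self, crossesAt_insertPerm_zero,
    Fin.succAbove_zero, crossesAt_insertPerm_succ, if_false, zero_add, and_false, h,
    Fin.succAbove_lt_succAbove_iff]

end Insert

theorem sum_pow_card_filter_gt {R α : Type*} [CommRing R] [LinearOrder α] (q : R)
    (s : Finset α) : ∑ a ∈ s, q ^ Finset.card {b ∈ s | a < b} = qInt q s.card := by
  induction s using Finset.induction_on_min with
  | empty => simp [qInt]
  | insert a s ha ih =>
    have has : a ∉ s := fun h => lt_irrefl _ (ha a h)
    rw [Finset.sum_insert has, Finset.card_insert_of_notMem has, qInt, Finset.sum_range_succ,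
      ← qInt, ← ih, add_comm]
    congr 1
    · refine Finset.sum_congr rfl fun b hb => ?_
      rw [Finset.filter_insert, if_neg (ha b hb).not_gt]
    · rw [Finset.filter_insert, if_neg (lt_irrefl a), Finset.filter_true_of_mem ha]

theorem sum_bool_insertNth {n : ℕ} {M : Type*} [AddCommMonoid M] (p : Fin (n + 1))
    (f : (Fin (n + 1) → Bool) → M) :
    ∑ S, f S = ∑ S, (f (p.insertNth true S) + f (p.insertNth false S)) := by
  rw [← (Fin.insertNthEquiv (fun _ => Bool) p).sum_comp, Fintype.sum_prod_type,
    Fintype.sum_bool, ← Finset.sum_add_distrib]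
  rfl

/-- Updating forgets only the bit at `g`, so mark sets correspond to pairs of a set containing `g`
and a free bit. -/
theorem sum_bool_update {n : ℕ} {M : Type*} [AddCommMonoid M] (g : Fin n)
    (f : (Fin n → Bool) → Bool → M) :
    ∑ S, f (Function.update S g true) (S g) =
      ∑ S, if S g = true then f S true + f S false else 0 := by
  cases n with
  | zero => exact g.elim0
  | succ n =>
    rw [sum_bool_insertNth g, sum_bool_insertNth g]
    simp

theorem card_insertNth {n : ℕ} (p : Fin (n + 1)) (r : Bool) (S : Fin n → Bool) :
    Finset.card {j | p.insertNth (α := fun _ => Bool) r S j = true}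
      = Finset.card {j | S j = true} + if r = true then 1 else 0 := by
  simp only [Finset.card_filter, Fin.sum_univ_succAbove _ p, Fin.insertNth_apply_same,
    Fin.insertNth_apply_succAbove]
  rw [add_comm]

theorem card_update_true {n : ℕ} (g : Fin n) (S : Fin n → Bool) :
    Finset.card {j | Function.update S g true j = true}
      = Finset.card {j | S j = true} + if S g = true then 0 else 1 := by
  cases n with
  | zero => exact g.elim0
  | succ n =>
    simp only [Finset.card_filter, Fin.sum_univ_succAbove _ g, Function.update_self, ne_eq,
      Fin.succAbove_ne, not_false_eq_true, Function.update_of_ne, if_true]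
    cases S g <;> simp
    ring

/-! ### The transfer operator on marked permutations -/

section Marked

variable {R : Type*} [CommRing R] (x q : R)

/-- The enumerator of crossings over permutations with marked positions, where `φ` is evaluated
at the number of marks. -/
noncomputable def markedPoly (n : ℕ) (φ : ℕ → R) : R :=
  ∑ w : Equiv.Perm (Fin n), ∑ S : Fin n → Bool,
    x ^ crossTotal w S * q ^ crossRight w S * φ (Finset.card {j | S j = true})

/-- The transfer operator for the insertion of a smallest letter. -/
def markedTransfer (φ : ℕ → R) (s : ℕ) : R :=
  x ^ s * (qInt q (s + 1) * φ (s + 1) + (qInt q s + qInt q (s + 1)) * φ s + qInt q s * φ (s - 1))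

theorem qInt_succ (n : ℕ) : qInt q (n + 1) = qInt q n + q ^ n := Finset.sum_range_succ _ _

/-- With `s` marks, `0` can be put back at the front or into a marked gap, and is crossed `s` times.
The crossings to its right number `s` at the front and run through `0, …, s - 1` over the marked
gaps. In a marked gap, removed letters may or may not remain on either side of `0`, so the mark
count becomes `s + 1`, `s` (twice) or `s - 1`; at the front only `s + 1` and `s` occur. -/
theorem markedPoly_succ (n : ℕ) (φ : ℕ → R) :
    markedPoly x q (n + 1) φ = markedPoly x q n (markedTransfer x q φ) := by
  rw [markedPoly, markedPoly, sum_perm_insert_position 0, Finset.sum_comm]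
  refine Finset.sum_congr rfl fun w _ => ?_
  set W : (Fin n → Bool) → R := fun S =>
    x ^ (Finset.card {j | S j = true} + crossTotal w S) * q ^ crossRight w S with hW
  have hp : ∀ p : Fin (n + 1), (∑ S : Fin (n + 1) → Bool,
        x ^ crossTotal (insertPerm p 0 w) S * q ^ crossRight (insertPerm p 0 w) S
          * φ (Finset.card {j | S j = true}))
      = ∑ S : Fin n → Bool, W (closeGap p S)
          * q ^ Finset.card {j : Fin n | p < j.succ ∧ closeGap p S j = true}
          * (φ (Finset.card {j | S j = true} + 1) + φ (Finset.card {j | S j = true})) := by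
    intro p
    rw [sum_bool_insertNth p]
    refine Finset.sum_congr rfl fun S _ => ?_
    simp only [crossTotal_insertPerm, crossRight_insertPerm, card_insertNth, hW]
    simp
    ring
  have hsucc : ∀ g : Fin n, (∑ S : Fin (n + 1) → Bool,
        x ^ crossTotal (insertPerm g.succ 0 w) S * q ^ crossRight (insertPerm g.succ 0 w) S
          * φ (Finset.card {j | S j = true}))
      = ∑ S : Fin n → Bool, if S g = true then
          W S * q ^ Finset.card {j : Fin n | g < j ∧ S j = true}
          * (φ (Finset.card {j | S j = true} + 1) + 2 * φ (Finset.card {j | S j = true})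
            + φ (Finset.card {j | S j = true} - 1)) else 0 := by
    intro g
    rw [hp]
    have h := sum_bool_update g (fun S l =>
      W S * q ^ Finset.card {j : Fin n | g < j ∧ S j = true}
        * (φ (Finset.card {j | S j = true} - (if l = true then 0 else 1) + 1)
          + φ (Finset.card {j | S j = true} - if l = true then 0 else 1)))
    refine Eq.trans (Finset.sum_congr rfl fun S _ => ?_) (h.trans ?_)
    · rw [card_update_true, Nat.add_sub_cancel, closeGap_succ]
      simp only [Fin.succ_lt_succ_iff]
    · refine Finset.sum_congr rfl fun S _ => ?_
      by_cases hS : S g = true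
      · have hpos : 0 < Finset.card {j | S j = true} :=
          Finset.card_pos.2 ⟨g, by simp [hS]⟩
        simp only [hS, if_true, Nat.sub_zero, Bool.false_eq_true, if_false]
        rw [Nat.sub_add_cancel hpos]
        ring
      · rw [if_neg hS, if_neg hS]
  rw [Fin.sum_univ_succ, hp, Finset.sum_congr rfl fun g _ => hsucc g, Finset.sum_comm,
    ← Finset.sum_add_distrib]
  refine Finset.sum_congr rfl fun S _ => ?_
  have hgt := sum_pow_card_filter_gt q ({j | S j = true} : Finset (Fin n))
  simp only [Finset.filter_filter] at hgt
  rw [← Finset.sum_filter, ← Finset.sum_mul, ← Finset.mul_sum]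
  simp only [and_comm (b := S _ = true), hgt, closeGap_zero, Fin.succ_pos, and_true, hW,
    markedTransfer, qInt_succ]
  ring

theorem markedPoly_zero (φ : ℕ → R) : markedPoly x q 0 φ = φ 0 := by
  simp [markedPoly, crossTotal, crossRight]

theorem markedPoly_eq_iterate (n : ℕ) (φ : ℕ → R) :
    markedPoly x q n φ = (markedTransfer x q)^[n] φ 0 := by
  induction n generalizing φ with
  | zero => exact markedPoly_zero x q φ
  | succ n ih => rw [markedPoly_succ, ih, Function.iterate_succ_apply]

end Marked

/-! ### Drops and right embracing numbers as crossings -/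

/-- A descent from `w a` to `w b` crosses the letters in `[w b, w a)`, which number `w a - w b`. -/
theorem permDrops_eq_crossTotal {n : ℕ} (w : Equiv.Perm (Fin n)) :
    permDrops w = crossTotal w fun _ => false := by
  classical
  have h : ∀ a b : Fin n, (if w b < w a then (w a : ℕ) - w b else 0)
      = ∑ i, if w b ≤ w i ∧ w i < w a then 1 else 0 := by
    intro a b
    rw [Equiv.sum_comp w fun i => if w b ≤ i ∧ i < w a then 1 else 0, ← Finset.card_filter]
    rw [show ({i | w b ≤ i ∧ i < w a} : Finset (Fin n)) = Finset.Ico (w b) (w a) by ext; simp,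
      Fin.card_Ico]
    split_ifs <;> omega
  have h2 : ∀ i a : Fin n, (if CrossesAt w (fun _ => false) (w i) a then 1 else 0)
      = ∑ b : Fin n, if (a : ℕ) + 1 = b then (if w b ≤ w i ∧ w i < w a then 1 else 0) else 0 := by
    intro i a
    by_cases hex : ∃ b : Fin n, (a : ℕ) + 1 = b
    · obtain ⟨b, hb⟩ := hex
      have huniq : ∀ k : Fin n, (a : ℕ) + 1 = k ↔ k = b := fun k => by omega
      simp [CrossesAt, huniq, and_comm]
    · rw [not_exists] at hex
      simp [CrossesAt, hex]
  rw [permDrops, Finset.sum_filter, Fintype.sum_prod_type, crossTotal]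
  simp only [Finset.card_filter, h2]
  refine Eq.trans ?_ Finset.sum_comm
  refine Finset.sum_congr rfl fun a _ => ?_
  refine Eq.trans ?_ Finset.sum_comm
  refine Finset.sum_congr rfl fun b _ => ?_
  by_cases hab : (a : ℕ) + 1 = b
  · simp only [hab, true_and, if_true, h]
  · simp [hab]

theorem strictAntiOn_Icc_of_le_of_le {α β : Type*} [LinearOrder α] [Preorder β] {f : α → β}
    {a j b : α} (haj : a ≤ j) (hjb : j ≤ b) (h1 : StrictAntiOn f (Set.Icc a j))
    (h2 : StrictAntiOn f (Set.Icc j b)) : StrictAntiOn f (Set.Icc a b) := by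
  rw [← Set.Icc_union_Icc_eq_Icc haj hjb]
  exact h1.union h2 (isGreatest_Icc haj) (isLeast_Icc hjb)

theorem IsDescentBlock.eq_of_mem {n : ℕ} {w : Equiv.Perm (Fin n)} {a b a' b' j : Fin n}
    (h : IsDescentBlock w a b) (h' : IsDescentBlock w a' b') (hj : j ∈ Set.Icc a b)
    (hj' : j ∈ Set.Icc a' b') : a = a' ∧ b = b' := by
  have h1 : StrictAntiOn w (Set.Icc (min a a') j) := by
    rcases min_choice a a' with e | e <;> rw [e]
    · exact h.2.1.mono (Set.Icc_subset_Icc_right hj.2)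
    · exact h'.2.1.mono (Set.Icc_subset_Icc_right hj'.2)
  have h2 : StrictAntiOn w (Set.Icc j (max b b')) := by
    rcases max_choice b b' with e | e <;> rw [e]
    · exact h.2.1.mono (Set.Icc_subset_Icc_left hj.1)
    · exact h'.2.1.mono (Set.Icc_subset_Icc_left hj'.1)
  have h3 := strictAntiOn_Icc_of_le_of_le (min_le_of_left_le hj.1) (le_max_of_le_left hj.2) h1 h2
  have e := h.2.2 _ _ (min_le_left _ _) (le_max_left _ _) h3
  have e' := h'.2.2 _ _ (min_le_right _ _) (le_max_right _ _) h3
  exact ⟨e.1.symm.trans e'.1, e.2.symm.trans e'.2⟩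

theorem exists_isDescentBlock_mem {n : ℕ} (w : Equiv.Perm (Fin n)) {j k : Fin n} (hjk : j ≤ k)
    (h : StrictAntiOn w (Set.Icc j k)) :
    ∃ a b, IsDescentBlock w a b ∧ a ≤ j ∧ k ≤ b := by
  classical
  obtain ⟨a, ha, hamin⟩ := Finset.exists_min_image
    ({a | a ≤ j ∧ StrictAntiOn w (Set.Icc a j)} : Finset (Fin n)) id ⟨j, by simp⟩
  obtain ⟨b, hb, hbmax⟩ := Finset.exists_max_image
    ({b | j ≤ b ∧ StrictAntiOn w (Set.Icc j b)} : Finset (Fin n)) id ⟨k, by simp [hjk, h]⟩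
  simp only [Finset.mem_filter, Finset.mem_univ, true_and, id] at ha hamin hb hbmax
  refine ⟨a, b, ⟨ha.1.trans hb.1, strictAntiOn_Icc_of_le_of_le ha.1 hb.1 ha.2 hb.2, ?_⟩, ha.1,
    hbmax k ⟨hjk, h⟩⟩
  intro a' b' haa hbb hanti
  exact ⟨le_antisymm haa (hamin a' ⟨haa.trans ha.1, hanti.mono
      (Set.Icc_subset_Icc_right (hb.1.trans hbb))⟩),
    le_antisymm (hbmax b' ⟨hb.1.trans hbb, hanti.mono
      (Set.Icc_subset_Icc_left (haa.trans ha.1))⟩) hbb⟩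

-- A descent block whose end letters enclose `w i` passes that value at exactly one of its descents.
-- Matching each block with this descent is injective in both directions, giving the two
-- inequalities.
open Classical in
theorem rightEmbracing_eq_card_crossesAt {n : ℕ} (w : Equiv.Perm (Fin n)) (i : Fin n) :
    rightEmbracing w i = Finset.card {j | i < j ∧ CrossesAt w (fun _ => false) (w i) j} := by
  let r : Fin n × Fin n → Fin n → Prop := fun B j => B.1 ≤ j ∧ j < B.2
  apply le_antisymm
  · refine Finset.card_le_card_of_forall_subsingleton r ?_ ?_
    · rintro ⟨a, b⟩ hB
      simp only [Finset.mem_filter, Finset.mem_univ, true_and] at hB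
      obtain ⟨hB, hab, hia, hwa, hwb⟩ := hB
      -- The crossing occurs at the last position of the block whose letter exceeds `w i`.
      obtain ⟨j, hj, hmax⟩ := Finset.exists_max_image
        ({j | a ≤ j ∧ j ≤ b ∧ w i < w j} : Finset (Fin n)) id ⟨a, by simp [hab.le, hwa]⟩
      simp only [Finset.mem_filter, Finset.mem_univ, true_and, id] at hj hmax
      have hjb : j < b := by
        refine lt_of_le_of_ne hj.2.1 ?_
        rintro rfl
        exact lt_asymm hwb hj.2.2
      have hk : (j : ℕ) + 1 < n := by omega
      refine ⟨j, ?_, hj.1, hjb⟩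
      simp only [Finset.mem_filter, Finset.mem_univ, true_and]
      refine ⟨hia.trans_le hj.1, hj.2.2, Or.inr ⟨⟨j + 1, hk⟩, rfl, ?_⟩⟩
      by_contra hlt
      have := hmax ⟨j + 1, hk⟩ ⟨by rw [Fin.le_def] at *; simp; omega,
        by rw [Fin.le_def]; simp; omega, not_le.1 hlt⟩
      rw [Fin.le_def] at this
      simp at this
    · rintro j - ⟨a, b⟩ ⟨hB, hr⟩ ⟨a', b'⟩ ⟨hB', hr'⟩
      simp only [Finset.mem_filter, Finset.mem_univ, true_and] at hB hB'
      obtain ⟨h1, h2⟩ := hB.1.eq_of_mem hB'.1 (j := j) ⟨hr.1, hr.2.le⟩ ⟨hr'.1, hr'.2.le⟩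
      rw [Prod.mk.injEq]
      exact ⟨h1, h2⟩
  · refine Finset.card_le_card_of_forall_subsingleton (fun j B => r B j) ?_ ?_
    · intro j hj
      simp only [Finset.mem_filter, Finset.mem_univ, true_and, CrossesAt, Bool.false_eq_true,
        false_or] at hj
      obtain ⟨hij, hwj, k, hk, hwk⟩ := hj
      have hjk : j < k := by omega
      have hanti : StrictAntiOn w (Set.Icc j k) := by
        intro s hs t ht hst
        obtain rfl : s = j := by
          have := hs.1; have := ht.2; rw [Fin.le_def] at *; omega
        obtain rfl : t = k := by
          have := ht.2; rw [Fin.le_def] at *; omega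
        exact hwk.trans_lt hwj
      obtain ⟨a, b, hB, haj, hkb⟩ := exists_isDescentBlock_mem w hjk.le hanti
      have hjB : j ∈ Set.Icc a b := ⟨haj, hjk.le.trans hkb⟩
      -- Were `i` in the block of `j`, then `i < j` would give `w j < w i`.
      have hia : i < a := by
        by_contra hai
        exact lt_asymm hwj (hB.2.1 ⟨not_lt.1 hai, hij.le.trans hjB.2⟩ hjB hij)
      refine ⟨(a, b), ?_, haj, hjk.trans_le hkb⟩
      simp only [Finset.mem_filter, Finset.mem_univ, true_and]
      refine ⟨hB, haj.trans_lt (hjk.trans_le hkb), hia, hwj.trans_le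
        (hB.2.1.antitoneOn ⟨le_rfl, hB.1⟩ hjB haj), lt_of_le_of_ne ((hB.2.1.antitoneOn
        ⟨haj.trans hjk.le, hkb⟩ ⟨hB.1, le_rfl⟩ hkb).trans hwk) fun e => ?_⟩
      have := w.injective e
      exact absurd (hia.trans_le hB.1) (by rw [this]; exact lt_irrefl _)
    · rintro ⟨a, b⟩ hB j ⟨hj, hr⟩ j' ⟨hj', hr'⟩
      simp only [Finset.mem_filter, Finset.mem_univ, true_and, CrossesAt, Bool.false_eq_true, false_or] at hB hj hj'
      -- Once a block has crossed `w i`, its later letters stay at or below that value.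
      have aux : ∀ s t : Fin n, a ≤ s → t ≤ b → w i < w t →
          (∃ k : Fin n, (s : ℕ) + 1 = k ∧ w k ≤ w i) → ¬ s < t := by
        rintro s t hs ht hwt ⟨k, hk, hwk⟩ hst
        have hkt : k ≤ t := by omega
        have hak : a ≤ k := by omega
        exact absurd (hwk.trans_lt hwt) (not_lt.2
          (hB.1.2.1.antitoneOn ⟨hak, hkt.trans ht⟩ ⟨hak.trans hkt, ht⟩ hkt))
      exact le_antisymm (not_lt.1 (aux j' j hr'.1 hr.2.le hj.2.1 hj'.2.2))
        (not_lt.1 (aux j j' hr.1 hr'.2.le hj'.2.1 hj.2.2))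

theorem permMad_eq_crossTotal_add_crossRight {n : ℕ} (w : Equiv.Perm (Fin n)) :
    permMad w = crossTotal w (fun _ => false) + crossRight w fun _ => false := by
  rw [permMad, permDrops_eq_crossTotal, crossRight]
  simp only [rightEmbracing_eq_card_crossesAt]

/-- As `mad` contains `drops`, every crossing weighs `x * q`, and crossings to the right weigh a
further `q`; `Pi.single 0 1` selects the empty set of marks. -/
theorem dropsMadPoly_eq_markedPoly {R : Type*} [CommRing R] (x q : R) (n : ℕ) :
    dropsMadPoly x q n = markedPoly (x * q) q n (Pi.single 0 1) := by
  refine Finset.sum_congr rfl fun w _ => ?_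
  rw [Finset.sum_eq_single fun _ => false]
  · rw [Finset.card_eq_zero.2 (Finset.filter_false_of_mem (by simp)), Pi.single_eq_same,
      permDrops_eq_crossTotal, permMad_eq_crossTotal_add_crossRight]
    ring
  · intro S _ hS
    rw [Pi.single_eq_of_ne, mul_zero]
    intro h
    rw [Finset.card_eq_zero, Finset.filter_eq_empty_iff] at h
    exact hS (funext fun j => by simpa using h (Finset.mem_univ j))
  · simp

theorem hasJFraction_dropsMadPoly {R : Type*} [CommRing R] (x q : R) (c b : ℕ → R)
    (hc : ∀ n : ℕ, c n = x ^ n * q ^ n * (qInt q n + qInt q (n + 1)))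
    (hb : ∀ n : ℕ, b (n + 1) = x ^ (2 * n + 1) * q ^ (2 * n + 1) * qInt q (n + 1) ^ 2) :
    HasJFraction (PowerSeries.mk fun n => dropsMadPoly x q n) c b := by
  have key := hasJFraction_of_recurrence c b (fun h => (x * q) ^ h * qInt q (h + 1))
    (fun h => (x * q) ^ h * qInt q h)
    (fun h m => (markedTransfer (x * q) q)^[m] (Pi.single 0 1) h) ?_ ?_ ?_ ?_ ?_
  · convert key using 2
    ext n
    rw [dropsMadPoly_eq_markedPoly, markedPoly_eq_iterate]
  · intro h
    rw [hb]
    ring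
  · simp
  · intro h
    simp
  · simp [qInt_zero]
  · intro h m
    rw [Function.iterate_succ_apply', markedTransfer, hc]
    ring

theorem mainTheorem4 {R : Type*} [CommRing R] (x q : R) (c b : ℕ → R)
    (hc : ∀ n : ℕ, c n = x ^ n * q ^ n * (qInt q n + qInt q (n + 1)))
    (hb : ∀ n : ℕ, b (n + 1) = x ^ (2 * n + 1) * q ^ (2 * n + 1) * qInt q (n + 1) ^ 2) :
    HasJFraction (PowerSeries.mk fun n => depInvPoly x q n) c b ∧
    HasJFraction (PowerSeries.mk fun n => dropsMadPoly x q n) c b ∧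
    ∀ n : ℕ, depInvPoly x q n = dropsMadPoly x q n := by
  have h1 := hasJFraction_depInvPoly x q c b hc hb
  have h2 := hasJFraction_dropsMadPoly x q c b hc hb
  refine ⟨h1, h2, fun n => ?_⟩
  simpa using congrArg (PowerSeries.coeff n) (h1.unique h2)
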